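/- For integers $n\ge 1$ and $j,k$, let $P_n(j,k)$ be the number of permutations $\sigma\in S_n$ that avoid the pattern $123$ (there are no $i_1<i_2<i_3$ with $\sigma(i_1)<\sigma(i_2)<\sigma(i_3)$) and satisfy $\sigma(j)=k$; thus $P_n(j,k)=0$ unless $1\le j,k\le n$. Let $C_n=\frac1{n+1}\binom{2n}{n}$. Let $0\le a,b\le 1$, $c\in\mathbb R$ and $0\le\alpha<1$. Define $$F(a,b,c,\alpha)=\sup\Big\{d\in\mathbb R_{\ge 0}\ \Big|\ \lim_{n\to\infty}\frac{n^d\,P_n(an-cn^\alpha+\delta,\ bn-cn^\alpha)}{C_n}\ \text{exists and is finite}\Big\}\in[0,\infty],$$ where $\delta=1$ if $\alpha=0$ and $a+b=1$, and $\delta=0$ otherwise. Here non-integer indices are rounded to integers, by any two fixed functions $r,s:\mathbb R\to\mathbb Z$ (one for each index) with $|r(x)-x|<1$ and $|s(x)-x|<1$ for all $x$, for instance the floor or the ceiling. Then, for every choice of $r$ and $s$, $$F(a,b,c,\alpha)=\begin{cases}\infty & \text{if } a+b\ne 1,\\ \infty & \text{if } a+b=1,\ c\ne 0,\ \alpha>\frac12,\\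 \frac32 & \text{if } a+b=1,\ 0<a<1,\ c=0,\\ \frac32-2\alpha & \text{if } a+b=1,\ 0<a<1,\ c\ne 0,\ \alpha\le\frac12.\end{cases}$$ -/

import Mathlib

open Filter Topology

noncomputable section

namespace PatternShape

/-- `σ ∈ S_n` contains the pattern `τ ∈ S_m`: for some indices `i_1 < ⋯ < i_m`, the sequence
`σ(i_1), …, σ(i_m)` is in the same relative order as `τ(1), …, τ(m)`. -/
def Contains {m n : ℕ} (σ : Equiv.Perm (Fin n)) (τ : Equiv.Perm (Fin m)) : Prop :=
  ∃ i : Fin m → Fin n, StrictMono i ∧ ∀ s t : Fin m, σ (i s) < σ (i t) ↔ τ s < τ t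

/-- The set of `τ`-avoiding permutations in `S_n`. -/
def avoiding {m : ℕ} (n : ℕ) (τ : Equiv.Perm (Fin m)) : Set (Equiv.Perm (Fin n)) :=
  {σ | ¬ Contains σ τ}

/-- The pattern `123`, the identity of `S_3`. -/
def pattern123 : Equiv.Perm (Fin 3) := 1

/-- `P n j k` is the number of `123`-avoiding `σ ∈ S_n` with `σ(j) = k`, where positions and values
are numbered `1, …, n` (and `Fin n` is numbered from `0`). There is no such permutation, and the
number is `0`, unless `1 ≤ j ≤ n` and `1 ≤ k ≤ n`. -/
def P (n : ℕ) (j k : ℤ) : ℕ :=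
  Set.ncard {σ : Equiv.Perm (Fin n) | σ ∈ avoiding n pattern123 ∧
    ∃ i : Fin n, ((i : ℕ) : ℤ) + 1 = j ∧ ((σ i : ℕ) : ℤ) + 1 = k}

/-- `r` rounds every real number to an integer at distance less than `1`, so that it fixes the
integers and sends any other real to its floor or its ceiling. -/
def IsRounding (r : ℝ → ℤ) : Prop :=
  ∀ x : ℝ, |(r x : ℝ) - x| < 1

open Classical in
/-- The shift of the first index: `1` if `α = 0` and `a + b = 1`, and `0` otherwise. -/
def shift (a b α : ℝ) : ℝ := if α = 0 ∧ a + b = 1 then 1 else 0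

/-- The decay exponent: the supremum, in the extended reals, of the `d ≥ 0` for which
`n ^ d * P_n(an - cn^α, bn - cn^α) / C_n` has a finite limit as `n → ∞`; the first index is
`an - cn^α + 1` if `α = 0` and `a + b = 1`. The indices are rounded to integers by `r` and `s`. -/
def F (r s : ℝ → ℤ) (a b c α : ℝ) : EReal :=
  sSup ((fun d : ℝ => (d : EReal)) '' {d : ℝ | 0 ≤ d ∧ ∃ l : ℝ,
    Tendsto (fun n : ℕ => (n : ℝ) ^ d *
      (P n (r (a * n - c * (n : ℝ) ^ α + shift a b α)) (s (b * n - c * (n : ℝ) ^ α)) : ℝ) /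
        (catalan n : ℝ)) atTop (𝓝 l)})

end PatternShape

end

namespace PatternShape

open Equiv

/-! The proof rests on an exact product formula and elementary bounds for binomial coefficients.

Exact count. If a `123`-avoider starts with a descent, its first entry can be removed; if it starts
with an ascent, its second entry is the maximum and can be removed. Hence the number with first
entry at most `f` satisfies the ballot recurrence, a Pascal rule with a reflecting boundary
(`ncard_first_eq`, `cnt_succ`). A marked point below the antidiagonal moves one position to the left
at each removal, until it is the first entry. So the recurrence also counts avoiders through that
point, and the count is a product of two ballot numbers (`cnt_hasPoint_add`). With `j`, `k` counted
from `0` and `n = j + k + e + 1`, `P = (e+1)² C(2j+e+1, j) C(2k+e+1, k) / ((2j+e+1)(2k+e+1))`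
(`P_mul`). Reverse-complement covers the other side of the antidiagonal.

Asymptotics. Write `E = e + 1`, one more than the distance to the antidiagonal. A Chernoff bound
gives `P ≤ 4^n exp(-E²/(2n))` (`P_le_exp`), so `P / C_n` decays faster than any power when `E` is at
least of order `n^β` with `β > 1/2`. Away from the corners, `P / C_n` is of exact order `E² /
n^(3/2)` as long as `E = O(√n)` (`P_mul_le`, `le_P_mul`). At the points of the theorem `E` has order
`n` if `a + b ≠ 1`, order `n^α` if `a + b = 1` and `c ≠ 0`, and is bounded if `a + b = 1` and `c =
0`. Rounding and the shift change `E` by a bounded amount, and `E ≥ 1` always. -/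

theorem mem_avoiding_pattern123_iff {n : ℕ} {σ : Perm (Fin n)} :
    σ ∈ avoiding n pattern123 ↔
      ∀ a b c : Fin n, a < b → b < c → σ a < σ b → ¬ σ b < σ c := by
  constructor
  · intro h a b c hab hbc h1 h2
    apply h
    have hm : StrictMono ![a, b, c] := by
      intro s t hst
      fin_cases s <;> fin_cases t <;> simp_all
      exact hab.trans hbc
    have hm' : StrictMono (fun s => σ (![a, b, c] s)) := by
      intro s t hst
      fin_cases s <;> fin_cases t <;> simp_all
      exact h1.trans h2
    exact ⟨![a, b, c], hm, fun s t => hm'.lt_iff_lt⟩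
  · rintro h ⟨i, hi, hσ⟩
    exact h (i 0) (i 1) (i 2) (hi (by decide)) (hi (by decide))
      ((hσ 0 1).2 (by simp [pattern123])) ((hσ 1 2).2 (by simp [pattern123]))

/-! ### Inserting and removing an entry of a `123`-avoider -/

/-- The permutation obtained from `τ` by inserting the value `k` at the position `i`. -/
def insertAt {n : ℕ} (i k : Fin (n + 1)) (τ : Perm (Fin n)) : Perm (Fin (n + 1)) :=
  (finSuccEquiv' i).trans ((Equiv.optionCongr τ).trans (finSuccEquiv' k).symm)

@[simp]
theorem insertAt_self {n : ℕ} (i k : Fin (n + 1)) (τ : Perm (Fin n)) : insertAt i k τ i = k := by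
  simp [insertAt]

@[simp]
theorem insertAt_succAbove {n : ℕ} (i k : Fin (n + 1)) (τ : Perm (Fin n)) (x : Fin n) :
    insertAt i k τ (i.succAbove x) = k.succAbove (τ x) := by
  simp [insertAt]

theorem insertAt_injective {n : ℕ} (i k : Fin (n + 1)) :
    Function.Injective (insertAt i k : Perm (Fin n) → Perm (Fin (n + 1))) := by
  intro τ τ' h
  ext x : 1
  have := congrArg (fun σ : Perm (Fin (n + 1)) => σ (i.succAbove x)) h
  simpa using this

theorem exists_insertAt_eq {n : ℕ} {i k : Fin (n + 1)} {σ : Perm (Fin (n + 1))} (h : σ i = k) :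
    ∃ τ, insertAt i k τ = σ := by
  have h1 : ∀ x : Fin n, ∃ y, k.succAbove y = σ (i.succAbove x) := by
    intro x
    apply Fin.exists_succAbove_eq
    rw [← h]
    exact fun hh => Fin.succAbove_ne i x (σ.injective hh)
  choose f hf using h1
  have hinj : Function.Injective f := by
    intro x y hxy
    have : σ (i.succAbove x) = σ (i.succAbove y) := by rw [← hf, ← hf, hxy]
    exact Fin.succAbove_right_injective (σ.injective this)
  refine ⟨Equiv.ofBijective f (Finite.injective_iff_bijective.1 hinj), ?_⟩
  ext x : 1
  rcases Fin.eq_self_or_eq_succAbove i x with rfl | ⟨y, rfl⟩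
  · simp [h]
  · simp [hf]

theorem mem_avoiding_of_insertAt {n : ℕ} {i k : Fin (n + 1)} {τ : Perm (Fin n)}
    (h : insertAt i k τ ∈ avoiding (n + 1) pattern123) : τ ∈ avoiding n pattern123 := by
  rw [mem_avoiding_pattern123_iff] at h ⊢
  intro a b c hab hbc h1 h2
  have := h (i.succAbove a) (i.succAbove b) (i.succAbove c)
  simp only [insertAt_succAbove, Fin.succAbove_lt_succAbove_iff] at this
  exact this hab hbc h1 h2

/-- In a `123` starting at the new entry, that entry could be replaced by its right neighbour, which
is smaller, giving a `123` in `τ`. -/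
theorem insertAt_zero_mem_avoiding {n : ℕ} {k : Fin (n + 2)} {τ : Perm (Fin (n + 1))}
    (h : τ ∈ avoiding (n + 1) pattern123) (hk : (τ 0 : ℕ) < k) :
    insertAt 0 k τ ∈ avoiding (n + 2) pattern123 := by
  rw [mem_avoiding_pattern123_iff] at h ⊢
  have hs : k.succAbove (τ 0) < k := by
    rw [Fin.succAbove_lt_iff_castSucc_lt, Fin.lt_def]; simpa using hk
  intro a b c hab hbc h1 h2
  rcases Fin.eq_self_or_eq_succAbove 0 b with rfl | ⟨b, rfl⟩
  · exact absurd hab (Fin.not_lt_zero a)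
  rcases Fin.eq_self_or_eq_succAbove 0 c with rfl | ⟨c, rfl⟩
  · exact absurd hbc (Fin.not_lt_zero _)
  rw [Fin.succAbove_lt_succAbove_iff] at hbc
  simp only [insertAt_succAbove, Fin.succAbove_lt_succAbove_iff] at h1 h2
  rcases Fin.eq_self_or_eq_succAbove 0 a with rfl | ⟨a, rfl⟩
  · rw [insertAt_self] at h1
    have h3 := Fin.succAbove_lt_succAbove_iff.1 (hs.trans h1)
    refine h 0 b c ?_ hbc h3 h2
    rcases Fin.eq_zero_or_eq_succ b with rfl | ⟨b, rfl⟩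
    · exact absurd h3 (lt_irrefl _)
    · exact Fin.succ_pos b
  · rw [Fin.succAbove_lt_succAbove_iff] at hab
    simp only [insertAt_succAbove, Fin.succAbove_lt_succAbove_iff] at h1
    exact h a b c hab hbc h1 h2

/-- The maximum could only play the role of `3`, but just one entry precedes it. -/
theorem insertAt_one_last_mem_avoiding {n : ℕ} {τ : Perm (Fin (n + 1))}
    (h : τ ∈ avoiding (n + 1) pattern123) :
    insertAt 1 (Fin.last (n + 1)) τ ∈ avoiding (n + 2) pattern123 := by
  rw [mem_avoiding_pattern123_iff] at h ⊢
  intro a b c hab hbc h1 h2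
  rcases Fin.eq_self_or_eq_succAbove 1 b with rfl | ⟨b, rfl⟩
  · rw [insertAt_self] at h2
    exact absurd (Fin.le_last _) (not_le.2 h2)
  rcases Fin.eq_self_or_eq_succAbove 1 a with rfl | ⟨a, rfl⟩
  · rw [insertAt_self] at h1
    exact absurd (Fin.le_last _) (not_le.2 h1)
  rcases Fin.eq_self_or_eq_succAbove 1 c with rfl | ⟨c, rfl⟩
  · rw [Fin.lt_def] at hab hbc
    simp only [Fin.val_one] at hbc
    omega
  simp only [insertAt_succAbove, Fin.succAbove_lt_succAbove_iff] at *
  exact h a b c hab hbc h1 h2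

/-- After an initial ascent, any larger entry further right would complete a `123`. -/
theorem apply_one_eq_last {n : ℕ} {σ : Perm (Fin (n + 2))}
    (h : σ ∈ avoiding (n + 2) pattern123) (h01 : σ 0 < σ 1) : σ 1 = Fin.last (n + 1) := by
  rw [mem_avoiding_pattern123_iff] at h
  by_contra hne
  have hlt : σ 1 < σ (σ.symm (Fin.last (n + 1))) := by
    simpa using Fin.lt_last_iff_ne_last.2 hne
  refine h 0 1 _ (by simp) ?_ h01 hlt
  generalize σ.symm (Fin.last (n + 1)) = c at hlt
  have h0 : c ≠ 0 := by rintro rfl; exact absurd h01 (not_lt.2 hlt.le)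
  have h1 : c ≠ 1 := by rintro rfl; exact lt_irrefl _ hlt
  rw [Ne, Fin.ext_iff, Fin.val_zero] at h0
  rw [Ne, Fin.ext_iff, Fin.val_one] at h1
  rw [Fin.lt_def, Fin.val_one]
  omega

/-! ### The ballot recurrence for the first entry -/

/-- The number of `123`-avoiding permutations of `n + 1` letters with the first entry at most `f`
(counted from `0`) and the property `p`. -/
noncomputable def cnt (n f : ℕ) (p : Perm (Fin (n + 1)) → Prop) : ℕ :=
  Set.ncard {σ : Perm (Fin (n + 1)) | σ ∈ avoiding (n + 1) pattern123 ∧ (σ 0 : ℕ) ≤ f ∧ p σ}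

/-- The bijection behind the recurrence. An initial descent corresponds to `τ 0 < f` with `f` put in
front; an initial ascent corresponds to `τ 0 = f` with the maximum put in second position. The
properties `p` and `p'` carry a marked point along. -/
theorem ncard_first_eq {n : ℕ} (f : Fin (n + 2)) {p : Perm (Fin (n + 2)) → Prop}
    {p' : Perm (Fin (n + 1)) → Prop}
    (h0 : ∀ τ, (τ 0 : ℕ) < f → (p (insertAt 0 f τ) ↔ p' τ))
    (h1 : ∀ τ, (τ 0 : ℕ) = f → (p (insertAt 1 (Fin.last (n + 1)) τ) ↔ p' τ)) :
    Set.ncard {σ : Perm (Fin (n + 2)) | σ ∈ avoiding (n + 2) pattern123 ∧ σ 0 = f ∧ p σ} =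
      cnt n f p' := by
  classical
  let Φ : Perm (Fin (n + 1)) → Perm (Fin (n + 2)) := fun τ =>
    if (τ 0 : ℕ) < f then insertAt 0 f τ else insertAt 1 (Fin.last (n + 1)) τ
  have e0 : ∀ τ : Perm (Fin (n + 1)), insertAt 0 f τ 1 = f.succAbove (τ 0) := fun τ => by
    rw [← insertAt_succAbove 0 f τ 0]; simp
  have e1 : ∀ τ : Perm (Fin (n + 1)),
      insertAt 1 (Fin.last (n + 1)) τ 0 = (τ 0).castSucc := fun τ => by
    have := insertAt_succAbove 1 (Fin.last (n + 1)) τ 0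
    simpa using this
  have l0 : ∀ x : Fin (n + 1), f.succAbove x < f ↔ (x : ℕ) < f := fun x => by
    rw [Fin.succAbove_lt_iff_castSucc_lt, Fin.lt_def]; simp
  have key : {σ : Perm (Fin (n + 2)) | σ ∈ avoiding (n + 2) pattern123 ∧ σ 0 = f ∧ p σ} =
      Φ '' {τ | τ ∈ avoiding (n + 1) pattern123 ∧ (τ 0 : ℕ) ≤ f ∧ p' τ} := by
    ext σ
    simp only [Set.mem_ofPred_eq, Set.mem_image]
    constructor
    · rintro ⟨ha, hf, hp⟩
      by_cases hlt : σ 1 < f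
      · obtain ⟨τ, rfl⟩ := exists_insertAt_eq hf
        rw [e0, l0] at hlt
        exact ⟨τ, ⟨mem_avoiding_of_insertAt ha, hlt.le, (h0 τ hlt).1 hp⟩, if_pos hlt⟩
      · have hne : σ 0 ≠ σ 1 := fun h => by simpa using σ.injective h
        have h01 : σ 0 < σ 1 := lt_of_le_of_ne (by rw [hf]; exact not_lt.1 hlt) hne
        obtain ⟨τ, rfl⟩ := exists_insertAt_eq (apply_one_eq_last ha h01)
        have hτ : (τ 0 : ℕ) = f := by rw [← hf, e1]; simp
        exact ⟨τ, ⟨mem_avoiding_of_insertAt ha, hτ.le, (h1 τ hτ).1 hp⟩, if_neg (by omega)⟩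
    · rintro ⟨τ, ⟨ha, hf, hp⟩, rfl⟩
      by_cases hlt : (τ 0 : ℕ) < f
      · simp only [Φ, if_pos hlt]
        exact ⟨insertAt_zero_mem_avoiding ha hlt, insertAt_self _ _ _, (h0 τ hlt).2 hp⟩
      · have hτ : (τ 0 : ℕ) = f := by omega
        simp only [Φ, if_neg hlt]
        exact ⟨insertAt_one_last_mem_avoiding ha, by rw [e1, Fin.ext_iff]; simpa using hτ,
          (h1 τ hτ).2 hp⟩
  rw [key, cnt, Set.InjOn.ncard_image]
  intro τ hτ τ' hτ' h
  have hle : f ≤ Fin.last (n + 1) := Fin.le_last f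
  simp only [Φ] at h
  split_ifs at h with h2 h3 h3
  · exact insertAt_injective _ _ h
  · have h4 := (l0 (τ 0)).2 h2
    rw [← e0, h, insertAt_self] at h4
    exact absurd hle (not_le.2 h4)
  · have h4 := (l0 (τ' 0)).2 h3
    rw [← e0, ← h, insertAt_self] at h4
    exact absurd hle (not_le.2 h4)
  · exact insertAt_injective _ _ h

theorem cnt_succ {n f : ℕ} (hf : f ≤ n) {p : Perm (Fin (n + 2)) → Prop}
    {p' : Perm (Fin (n + 1)) → Prop}
    (h0 : ∀ τ, (τ 0 : ℕ) < f + 1 → (p (insertAt 0 ⟨f + 1, by omega⟩ τ) ↔ p' τ))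
    (h1 : ∀ τ, (τ 0 : ℕ) = f + 1 → (p (insertAt 1 (Fin.last (n + 1)) τ) ↔ p' τ)) :
    cnt (n + 1) (f + 1) p = cnt (n + 1) f p + cnt n (f + 1) p' := by
  rw [show cnt n (f + 1) p' = _ from (ncard_first_eq ⟨f + 1, by omega⟩ h0 h1).symm, cnt, cnt,
    ← Set.ncard_union_eq]
  · congr 1
    ext σ
    simp only [Set.mem_ofPred_eq, Set.mem_union, Fin.ext_iff]
    constructor
    · rintro ⟨h2, h3, h4⟩
      rcases Nat.lt_or_ge f (σ 0) with h | h
      · exact Or.inr ⟨h2, by omega, h4⟩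
      · exact Or.inl ⟨h2, h, h4⟩
    · rintro (⟨h2, h3, h4⟩ | ⟨h2, h3, h4⟩)
      · exact ⟨h2, by omega, h4⟩
      · exact ⟨h2, by omega, h4⟩
  · rw [Set.disjoint_left]
    rintro σ ⟨_, h2, _⟩ ⟨_, h3, _⟩
    rw [Fin.ext_iff] at h3
    simp only at h3
    omega

theorem cnt_eq_of_le {n f f' : ℕ} (hf : n ≤ f) (hf' : n ≤ f') (p : Perm (Fin (n + 1)) → Prop) :
    cnt n f p = cnt n f' p := by
  unfold cnt
  congr 1
  ext σ
  have := (σ 0).2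
  simp only [Set.mem_ofPred_eq]
  constructor <;> rintro ⟨h1, -, h3⟩ <;> exact ⟨h1, by omega, h3⟩

theorem mem_avoiding_one (σ : Perm (Fin 1)) : σ ∈ avoiding 1 pattern123 := by
  rw [mem_avoiding_pattern123_iff]
  intro a b c hab
  exact absurd hab (by rw [Subsingleton.elim a b]; exact lt_irrefl _)

theorem cnt_zero_true (f : ℕ) : cnt 0 f (fun _ => True) = 1 := by
  rw [cnt, Set.ncard_eq_one]
  refine ⟨1, ?_⟩
  ext σ
  simp only [Set.mem_ofPred_eq, Set.mem_singleton_iff, and_true]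
  refine ⟨fun _ => Equiv.ext fun i => Subsingleton.elim (α := Fin 1) _ _, fun _ => ⟨mem_avoiding_one σ, ?_⟩⟩
  have := (σ 0).2
  omega

/-- The difference of binomials obeys Pascal's rule. The range includes `f = n + 1`, one beyond the
largest entry: there the count stays constant and the extra terms cancel by symmetry of the
binomials, which is the reflection at the boundary. -/
theorem cnt_true_add_choose (n f : ℕ) (hf : f ≤ n + 1) :
    cnt n f (fun _ => True) + (n + 1 + f).choose (n + 2) = (n + 1 + f).choose (n + 1) := by
  induction n generalizing f with
  | zero =>
    rw [cnt_zero_true]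
    interval_cases f <;> decide
  | succ n ih =>
    have main : ∀ f, f ≤ n + 1 → cnt (n + 1) f (fun _ => True) + (n + 1 + 1 + f).choose (n + 1 + 2)
        = (n + 1 + 1 + f).choose (n + 1 + 1) := by
      intro f
      induction f with
      | zero =>
        intro _
        have h1 : cnt (n + 1) 0 (fun _ => True) = cnt n 0 (fun _ => True) := by
          have h := ncard_first_eq (n := n) (p := fun _ => True) (p' := fun _ => True) 0
            (by simp) (by simp)
          rw [Fin.val_zero] at h
          rw [← h, cnt]
          simp
        have := ih 0 (by omega)
        simp at this ⊢
        omega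
      | succ f ihf =>
        intro hf'
        have h1 := ihf (by omega)
        have h2 := ih (f + 1) hf'
        rw [cnt_succ (p' := fun _ => True) (by omega) (by simp) (by simp)]
        rw [show n + 1 + 1 + (f + 1) = (n + 1 + 1 + f) + 1 by ring, Nat.choose_succ_succ' _ (n + 2),
          Nat.choose_succ_succ' _ (n + 1)]
        rw [show n + 1 + (f + 1) = n + 1 + 1 + f by ring] at h2
        simp only [add_assoc, Nat.reduceAdd] at *
        omega
    rcases Nat.lt_or_ge f (n + 2) with h | h
    · exact main f (by omega)
    · obtain rfl : f = n + 1 + 1 := by omega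
      have h1 := main (n + 1) le_rfl
      rw [cnt_eq_of_le (by omega) (le_refl (n + 1))]
      rw [show n + 1 + 1 + (n + 1 + 1) = (n + 1 + 1 + (n + 1)) + 1 by ring,
        Nat.choose_succ_succ' _ (n + 2), Nat.choose_succ_succ' _ (n + 1)]
      have h2 := Nat.choose_symm_of_eq_add (n := n + 1 + 1 + (n + 1)) (a := n + 1) (b := n + 2)
        (by omega)
      simp only [add_assoc, Nat.reduceAdd] at *
      omega

/-! ### Avoiders through a given point -/

/-- The value at position `j` is `k`, both counted from `0`. -/
def HasPoint {n : ℕ} (j k : ℕ) (σ : Perm (Fin n)) : Prop :=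
  ∃ i : Fin n, (i : ℕ) = j ∧ (σ i : ℕ) = k

/-- The number of `123`-avoiding permutations of `m + 1` letters with first entry `k`. -/
noncomputable def firstCount (m k : ℕ) : ℕ :=
  Set.ncard {σ : Perm (Fin (m + 1)) | σ ∈ avoiding (m + 1) pattern123 ∧ (σ 0 : ℕ) = k}

theorem firstCount_add_choose (k e : ℕ) :
    firstCount (k + e) k + (2 * k + e).choose (k + e + 1) = (2 * k + e).choose k := by
  have hsymm := Nat.choose_symm_of_eq_add (n := 2 * k + e) (a := k) (b := k + e) (by ring)
  rw [hsymm]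
  generalize h : k + e = m
  unfold firstCount
  rcases m with _ | n
  · obtain ⟨rfl, rfl⟩ : k = 0 ∧ e = 0 := by omega
    have := cnt_zero_true 0
    simpa [cnt] using this
  · have h1 := cnt_true_add_choose n k (by omega)
    have h2 := ncard_first_eq (n := n) (f := ⟨k, by omega⟩) (p := fun _ => True)
      (p' := fun _ => True) (by simp) (by simp)
    simp only [Fin.ext_iff, and_true] at h2
    rw [h2, show 2 * k + e = n + 1 + k by omega]
    exact h1

theorem hasPoint_insertAt_zero {n j k : ℕ} {f : Fin (n + 2)} (hk : k < f)
    (τ : Perm (Fin (n + 1))) : HasPoint (j + 1) k (insertAt 0 f τ) ↔ HasPoint j k τ := by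
  have l0 : ∀ x : Fin (n + 1), ((f.succAbove x : Fin (n + 2)) : ℕ) = k ↔ (x : ℕ) = k := fun x => by
    unfold Fin.succAbove
    split_ifs with h
    · simp
    · rw [Fin.lt_def] at h
      simp only [Fin.val_castSucc, Fin.val_succ] at h ⊢
      omega
  constructor
  · rintro ⟨i, hi, h⟩
    rcases Fin.eq_self_or_eq_succAbove 0 i with rfl | ⟨i, rfl⟩
    · simp at hi
    · rw [insertAt_succAbove, l0] at h
      exact ⟨i, by simpa using hi, h⟩
  · rintro ⟨i, hi, h⟩
    exact ⟨Fin.succAbove 0 i, by simpa using hi, by rw [insertAt_succAbove, l0]; exact h⟩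

theorem hasPoint_insertAt_one {n j k : ℕ} {τ : Perm (Fin (n + 1))} (hk : k < τ 0) :
    HasPoint (j + 1) k (insertAt 1 (Fin.last (n + 1)) τ) ↔ HasPoint j k τ := by
  have hn := (τ 0).2
  constructor
  · rintro ⟨i, hi, h⟩
    rcases Fin.eq_self_or_eq_succAbove 1 i with rfl | ⟨i, rfl⟩
    · rw [insertAt_self] at h
      simp at h
      omega
    · rw [insertAt_succAbove] at h
      rcases Fin.eq_zero_or_eq_succ i with rfl | ⟨i, rfl⟩
      · simp at hi
      · refine ⟨i.succ, ?_, by simpa using h⟩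
        rw [Fin.succAbove_of_le_castSucc _ _ (by simp [Fin.le_def])] at hi
        simpa using hi
  · rintro ⟨i, hi, h⟩
    rcases Fin.eq_zero_or_eq_succ i with rfl | ⟨i, rfl⟩
    · omega
    · refine ⟨Fin.succAbove 1 i.succ, ?_, by rw [insertAt_succAbove]; simpa using h⟩
      rw [Fin.succAbove_of_le_castSucc _ _ (by simp [Fin.le_def])]
      simpa using hi

/-- If `j + k ≤ n` for a point `(j, k)` of a `123`-avoiding permutation of `n + 1` letters and
`0 < j`, then the first entry exceeds `k`. -/
theorem lt_apply_zero {n j k : ℕ} (hjk : j + 1 + k ≤ n) {σ : Perm (Fin (n + 1))}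
    (h : σ ∈ avoiding (n + 1) pattern123) (hp : HasPoint (j + 1) k σ) : k < σ 0 := by
  obtain ⟨i, hi, hk⟩ := hp
  rw [mem_avoiding_pattern123_iff] at h
  have h0i : 0 < i := by rw [Fin.lt_def, Fin.val_zero]; omega
  by_contra hlt
  have h0 : σ 0 < σ i := by
    refine lt_of_le_of_ne (by rw [Fin.le_def]; omega) fun hh => h0i.ne (σ.injective hh)
  -- If `σ 0 < σ i`, every entry after `i` lies below `σ i`. With the first entry this makes `n - j`
  -- distinct values among the `k` values below `σ i`.
  have hc : (insert 0 (Finset.Ioi i)).card ≤ (Finset.Iio (σ i)).card := by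
    refine Finset.card_le_card_of_injOn σ ?_ σ.injective.injOn
    intro c hc
    simp only [Finset.coe_insert, Set.mem_insert_iff, Finset.mem_coe, Finset.mem_Ioi] at hc
    simp only [Finset.coe_Iio, Set.mem_Iio]
    rcases hc with rfl | hc
    · exact h0
    · exact lt_of_le_of_ne (not_lt.1 (h 0 i c h0i hc h0)) fun hh => hc.ne' (σ.injective hh)
  rw [Finset.card_insert_of_notMem (by simp), Fin.card_Ioi, Fin.card_Iio] at hc
  omega

/-- Each removal lowers `j` by one and leaves `k` and `e` fixed. At `j = 0` the count is `firstCount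
(k + e) k`, which stays a constant factor, and the dependence on `j` and `y` is again a ballot
number. -/
theorem cnt_hasPoint_add (j k e y n : ℕ) (hn : n = j + k + e) (hy : y ≤ j + e) :
    cnt n (k + y + 1) (HasPoint j k) + firstCount (k + e) k * (y + j).choose (j + e + 1) =
      firstCount (k + e) k * (y + j).choose j := by
  induction j generalizing n y with
  | zero =>
    rw [Nat.choose_eq_zero_of_lt (by omega)]
    simp only [Nat.choose_zero_right, mul_zero, mul_one, add_zero, cnt, firstCount]
    subst hn
    rw [Nat.zero_add]
    congr 1
    ext σ
    simp only [Set.mem_ofPred_eq, HasPoint]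
    constructor
    · rintro ⟨h1, -, i, hi, h2⟩
      obtain rfl : i = 0 := by ext; simpa using hi
      exact ⟨h1, h2⟩
    · rintro ⟨h1, h2⟩
      exact ⟨h1, by omega, 0, rfl, h2⟩
  | succ j ih =>
    obtain ⟨m, rfl⟩ : ∃ m, n = m + 1 := ⟨j + k + e, by omega⟩
    have hm : m = j + k + e := by omega
    -- Starting value of the recurrence in `y`: the first entry must exceed `k`.
    have hz : cnt (m + 1) k (HasPoint (j + 1) k) = 0 := by
      rw [cnt, Set.ncard_eq_zero]
      ext σ
      simp only [Set.mem_ofPred_eq, Set.mem_empty_iff_false, iff_false]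
      rintro ⟨h1, h2, h3⟩
      have := lt_apply_zero (by omega) h1 h3
      omega
    have hstep : ∀ z, k + z ≤ m → cnt (m + 1) (k + z + 1) (HasPoint (j + 1) k) =
        cnt (m + 1) (k + z) (HasPoint (j + 1) k) + cnt m (k + z + 1) (HasPoint j k) := by
      intro z hz
      apply cnt_succ hz
      · intro τ _
        exact hasPoint_insertAt_zero (by simp only; omega) τ
      · intro τ hτ
        exact hasPoint_insertAt_one (by omega)
    have main : ∀ y, y ≤ j + e → cnt (m + 1) (k + y + 1) (HasPoint (j + 1) k) +
        firstCount (k + e) k * (y + (j + 1)).choose (j + 1 + e + 1) =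
        firstCount (k + e) k * (y + (j + 1)).choose (j + 1) := by
      intro y
      induction y with
      | zero =>
        intro _
        have h1 := ih 0 m hm (by omega)
        rw [hstep 0 (by omega), Nat.add_zero k, hz, zero_add]
        rw [Nat.choose_eq_zero_of_lt (by omega)] at h1 ⊢
        simpa using h1
      | succ y ihy =>
        intro hy'
        have h1 := ihy (by omega)
        have h2 := ih (y + 1) m hm hy'
        rw [hstep (y + 1) (by omega), ← add_assoc k y 1]
        rw [show y + 1 + (j + 1) = (y + (j + 1)) + 1 by ring, Nat.choose_succ_succ' _ (j + 1 + e),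
          Nat.choose_succ_succ' _ j]
        rw [show y + 1 + j = y + (j + 1) by ring, show j + e + 1 = j + 1 + e by ring] at h2
        simp only [mul_add]
        rw [← add_assoc k y 1] at h2
        omega
    rcases Nat.lt_or_ge y (j + e + 1) with h | h
    · exact main y (by omega)
    -- The bound on the first entry now exceeds every entry, so the count equals that for `y = j +
    -- e`; the two new binomials agree by symmetry.
    · obtain rfl : y = j + e + 1 := by omega
      have h1 := main (j + e) le_rfl
      rw [cnt_eq_of_le (by omega) (show m + 1 ≤ k + (j + e) + 1 by omega)]
      rw [show j + e + 1 + (j + 1) = (j + e + (j + 1)) + 1 by ring,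
        Nat.choose_succ_succ' _ (j + 1 + e), Nat.choose_succ_succ' _ j]
      have h2 := Nat.choose_symm_of_eq_add (n := j + e + (j + 1)) (a := j) (b := j + 1 + e)
        (by omega)
      rw [h2]
      simp only [mul_add]
      omega

theorem P_eq_cnt (j k n f : ℕ) (hf : n ≤ f) :
    P (n + 1) ((j : ℤ) + 1) ((k : ℤ) + 1) = cnt n f (HasPoint j k) := by
  unfold P cnt HasPoint
  congr 1
  ext σ
  have := (σ 0).2
  simp only [Set.mem_ofPred_eq]
  constructor
  · rintro ⟨h1, i, h2, h3⟩
    exact ⟨h1, by omega, i, by omega, by omega⟩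
  · rintro ⟨h1, -, i, h2, h3⟩
    exact ⟨h1, i, by omega, by omega⟩

/-! ### The product formula and the reversal symmetry -/

theorem mul_ballot {j e B : ℕ} (h : B + (2 * j + e).choose (j + e + 1) = (2 * j + e).choose j) :
    (2 * j + e + 1) * B = (e + 1) * (2 * j + e + 1).choose j := by
  have h1 := Nat.choose_mul_succ_eq (2 * j + e) j
  have h2 := Nat.choose_mul_succ_eq (2 * j + e) (j + e + 1)
  have h3 := Nat.choose_symm_of_eq_add (n := 2 * j + e + 1) (a := j) (b := j + e + 1) (by ring)
  rw [← h3, show 2 * j + e + 1 - (j + e + 1) = j by omega] at h2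
  rw [show 2 * j + e + 1 - j = j + e + 1 by omega, ← h] at h1
  nlinarith

theorem P_mul (j k e : ℕ) :
    P (j + k + e + 1) ((j : ℤ) + 1) ((k : ℤ) + 1) * ((2 * j + e + 1) * (2 * k + e + 1)) =
      (e + 1) ^ 2 * ((2 * j + e + 1).choose j * (2 * k + e + 1).choose k) := by
  -- With `y = j + e` the bound on the first entry is `n + 1`, hence no restriction.
  have h1 := cnt_hasPoint_add j k e (j + e) _ rfl le_rfl
  rw [← P_eq_cnt _ _ _ _ (by omega), show j + e + j = 2 * j + e by ring] at h1
  have h2 := firstCount_add_choose k e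
  have h3 := mul_ballot h2
  obtain ⟨B, hB⟩ : ∃ B, B + (2 * j + e).choose (j + e + 1) = (2 * j + e).choose j := by
    refine ⟨(2 * j + e).choose j - (2 * j + e).choose (j + e + 1), Nat.sub_add_cancel ?_⟩
    have := firstCount_add_choose j e
    omega
  have h4 := mul_ballot hB
  rw [← hB, mul_add] at h1
  have h5 : P (j + k + e + 1) ((j : ℤ) + 1) ((k : ℤ) + 1) = firstCount (k + e) k * B := by omega
  rw [h5]
  calc firstCount (k + e) k * B * ((2 * j + e + 1) * (2 * k + e + 1))
      = ((2 * j + e + 1) * B) * ((2 * k + e + 1) * firstCount (k + e) k) := by ring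
    _ = _ := by rw [h3, h4]; ring

theorem P_eq_zero {n : ℕ} {j k : ℤ} (h : ¬ ((1 ≤ j ∧ j ≤ n) ∧ (1 ≤ k ∧ k ≤ n))) : P n j k = 0 := by
  rw [P, Set.ncard_eq_zero]
  ext σ
  simp only [Set.mem_ofPred_eq, Set.mem_empty_iff_false, iff_false]
  rintro ⟨-, i, h1, h2⟩
  have := i.2
  have := (σ i).2
  omega

/-- Conjugation by the reversal. -/
def revConj (n : ℕ) : Perm (Perm (Fin n)) := Fin.revPerm.permCongr

theorem revConj_apply {n : ℕ} (σ : Perm (Fin n)) (i : Fin n) :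
    revConj n σ i = (σ i.rev).rev := by
  simp [revConj]

theorem revConj_mem_avoiding {n : ℕ} {σ : Perm (Fin n)} (h : σ ∈ avoiding n pattern123) :
    revConj n σ ∈ avoiding n pattern123 := by
  rw [mem_avoiding_pattern123_iff] at h ⊢
  intro a b c hab hbc h1 h2
  simp only [revConj_apply, Fin.rev_lt_rev] at h1 h2
  exact h c.rev b.rev a.rev (Fin.rev_lt_rev.2 hbc) (Fin.rev_lt_rev.2 hab) h2 h1

theorem P_le_P_rev (n : ℕ) (j k : ℤ) : P n j k ≤ P n (n + 1 - j) (n + 1 - k) := by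
  unfold P
  refine Set.ncard_le_ncard_of_injOn (revConj n) ?_ (revConj n).injective.injOn (Set.toFinite _)
  rintro σ ⟨h, i, h1, h2⟩
  refine ⟨revConj_mem_avoiding h, i.rev, ?_, ?_⟩
  · rw [Fin.val_rev]
    have := i.2
    omega
  · rw [revConj_apply, Fin.rev_rev, Fin.val_rev]
    have := (σ i).2
    omega

theorem P_rev (n : ℕ) (j k : ℤ) : P n (n + 1 - j) (n + 1 - k) = P n j k := by
  refine le_antisymm ?_ (P_le_P_rev n j k)
  have := P_le_P_rev n (n + 1 - j) (n + 1 - k)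
  rwa [sub_sub_cancel, sub_sub_cancel] at this

/-! ### Bounds for binomial coefficients -/

theorem centralBinom_sq_mul_le (j : ℕ) : (j.centralBinom : ℝ) ^ 2 * (2 * j + 1) ≤ 16 ^ j := by
  induction j with
  | zero => simp
  | succ j ih =>
    have h : ((j : ℝ) + 1) * (j + 1).centralBinom = 2 * (2 * j + 1) * j.centralBinom := by
      exact_mod_cast Nat.succ_mul_centralBinom_succ j
    have hj : (0 : ℝ) < (j + 1) ^ 2 := by positivity
    refine le_of_mul_le_mul_left ?_ hj
    push_cast
    calc ((j : ℝ) + 1) ^ 2 * ((j + 1).centralBinom ^ 2 * (2 * (j + 1) + 1))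
        = (((j : ℝ) + 1) * (j + 1).centralBinom) ^ 2 * (2 * j + 3) := by ring
      _ = (4 * ((2 * j + 1) * (2 * j + 3))) * ((j.centralBinom : ℝ) ^ 2 * (2 * j + 1)) := by
          rw [h]; ring
      _ ≤ (4 * (4 * (j + 1) ^ 2)) * 16 ^ j := by
          have h2 : (2 * (j : ℝ) + 1) * (2 * j + 3) ≤ 4 * (j + 1) ^ 2 := by nlinarith
          exact mul_le_mul (by linarith) ih (by positivity) (by positivity)
      _ = _ := by ring

theorem le_centralBinom_sq_mul {j : ℕ} (hj : 1 ≤ j) :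
    (16 : ℝ) ^ j ≤ (j.centralBinom : ℝ) ^ 2 * (4 * j) := by
  induction j, hj using Nat.le_induction with
  | base => norm_num [Nat.centralBinom, Nat.choose]
  | succ j _ ih =>
    have h : ((j : ℝ) + 1) * (j + 1).centralBinom = 2 * (2 * j + 1) * j.centralBinom := by
      exact_mod_cast Nat.succ_mul_centralBinom_succ j
    have hj : (0 : ℝ) < (j + 1) ^ 2 := by positivity
    refine le_of_mul_le_mul_left ?_ hj
    push_cast
    calc ((j : ℝ) + 1) ^ 2 * 16 ^ (j + 1)
        = 16 * (j + 1) ^ 2 * 16 ^ j := by ring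
      _ ≤ 16 * (j + 1) ^ 2 * ((j.centralBinom : ℝ) ^ 2 * (4 * j)) := by gcongr
      _ = 16 * (j + 1) * (j.centralBinom : ℝ) ^ 2 * (4 * j * (j + 1)) := by ring
      _ ≤ 16 * (j + 1) * (j.centralBinom : ℝ) ^ 2 * (2 * j + 1) ^ 2 := by
          gcongr
          nlinarith
      _ = (((j : ℝ) + 1) * (j + 1).centralBinom) ^ 2 * (4 * (j + 1)) := by rw [h]; ring
      _ = _ := by ring

theorem centralBinom_mul_sqrt_le (j : ℕ) : (j.centralBinom : ℝ) * √j ≤ 4 ^ j := by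
  apply le_of_sq_le_sq _ (by positivity)
  rw [mul_pow, Real.sq_sqrt (by positivity), ← pow_mul, mul_comm j, pow_mul]
  refine le_trans ?_ ((centralBinom_sq_mul_le j).trans (by norm_num))
  gcongr
  have : (0 : ℝ) ≤ j := by positivity
  linarith

theorem le_centralBinom_mul_sqrt {j : ℕ} (hj : 1 ≤ j) :
    (4 : ℝ) ^ j ≤ 2 * ((j.centralBinom : ℝ) * √j) := by
  apply le_of_sq_le_sq _ (by positivity)
  rw [mul_pow, mul_pow, Real.sq_sqrt (by positivity), ← pow_mul, mul_comm j, pow_mul]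
  have := le_centralBinom_sq_mul hj
  norm_num at this ⊢
  linarith

theorem choose_succ_mul_real (j e : ℕ) :
    ((2 * j + (e + 1)).choose j : ℝ) * (j + e + 1) = (2 * j + e).choose j * (2 * j + e + 1) := by
  have h := Nat.choose_mul_succ_eq (2 * j + e) j
  rw [show 2 * j + e + 1 - j = j + e + 1 by omega] at h
  exact_mod_cast h.symm

theorem choose_le_centralBinom_mul (j e : ℕ) :
    ((2 * j + e).choose j : ℝ) ≤ j.centralBinom * 2 ^ e := by
  induction e with
  | zero => simp [Nat.centralBinom]
  | succ e ih =>
    have h : (0 : ℝ) < j + e + 1 := by positivity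
    refine le_of_mul_le_mul_right ?_ h
    rw [choose_succ_mul_real]
    calc ((2 * j + e).choose j : ℝ) * (2 * j + e + 1)
        ≤ j.centralBinom * 2 ^ e * (2 * (j + e + 1)) := by
          gcongr
          have : (0 : ℝ) ≤ e := by positivity
          linarith
      _ = _ := by ring

theorem exp_neg_two_mul_le {x : ℝ} (h0 : 0 ≤ x) (h1 : x ≤ 1 / 2) :
    Real.exp (-(2 * x)) ≤ 1 - x := by
  rw [Real.exp_neg, inv_le_comm₀ (Real.exp_pos _) (by linarith)]
  have h2 := Real.add_one_le_exp (2 * x)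
  refine le_trans ?_ h2
  rw [inv_le_iff_one_le_mul₀ (by linarith)]
  nlinarith

/-- Raising `e` by one multiplies the binomial by `2 (1 - x)` with `x = (e+1) / (2(j+e+1))`. Here `1
- x ≥ exp(-2x)` and `2x ≤ (e+1)/j`, which is at most the increment `(2e+1)/j` of `e²/j`. -/
theorem centralBinom_mul_exp_le_choose {j : ℕ} (hj : 1 ≤ j) (e : ℕ) :
    (j.centralBinom : ℝ) * 2 ^ e * Real.exp (-((e : ℝ) ^ 2 / j)) ≤ (2 * j + e).choose j := by
  induction e with
  | zero => simp [Nat.centralBinom]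
  | succ e ih =>
    have h : (0 : ℝ) < j + e + 1 := by positivity
    have hj' : (1 : ℝ) ≤ j := by exact_mod_cast hj
    have he : (0 : ℝ) ≤ e := by positivity
    refine le_of_mul_le_mul_right ?_ h
    rw [choose_succ_mul_real]
    set x : ℝ := (e + 1) / (2 * (j + e + 1)) with hx
    have hx1 : x ≤ 1 / 2 := by
      rw [hx, div_le_div_iff₀ (by positivity) (by norm_num)]
      linarith
    have h1 := exp_neg_two_mul_le (x := x) (by positivity) hx1
    have h2 : (1 - x) * (2 * (j + e + 1)) = 2 * j + e + 1 := by
      rw [hx]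
      field_simp
      ring
    have h3 : Real.exp (-(((e + 1 : ℕ) : ℝ) ^ 2 / j)) ≤
        Real.exp (-((e : ℝ) ^ 2 / j)) * Real.exp (-(2 * x)) := by
      rw [← Real.exp_add]
      apply Real.exp_le_exp.2
      have : 2 * x ≤ (e + 1) / j := by
        rw [hx, mul_div_assoc', mul_div_mul_left _ _ two_ne_zero]
        gcongr
        linarith
      have h4 : (((e + 1 : ℕ) : ℝ) ^ 2 / j) - (e : ℝ) ^ 2 / j - (e + 1) / j = e / j := by
        push_cast
        ring
      have h5 : 0 ≤ (e : ℝ) / j := by positivity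
      linarith
    calc (j.centralBinom : ℝ) * 2 ^ (e + 1) * Real.exp (-(((e + 1 : ℕ) : ℝ) ^ 2 / j)) *
          (j + e + 1)
        ≤ (j.centralBinom : ℝ) * 2 ^ (e + 1) *
          (Real.exp (-((e : ℝ) ^ 2 / j)) * (1 - x)) * (j + e + 1) := by
          gcongr
          exact h3.trans (by gcongr)
      _ = (j.centralBinom : ℝ) * 2 ^ e * Real.exp (-((e : ℝ) ^ 2 / j)) *
          ((1 - x) * (2 * (j + e + 1))) := by ring
      _ ≤ _ := by
          rw [h2]
          gcongr

/-- Chernoff bound: one term of the expansion of `(exp(-t) + exp t)^N` is at most `(2 cosh t)^N ≤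
2^N exp(N t²/2)`, and `t = e / N` is the optimal choice. -/
theorem choose_le_two_pow_mul_exp (j e : ℕ) (he : 1 ≤ e) :
    ((2 * j + e).choose j : ℝ) ≤
      2 ^ (2 * j + e) * Real.exp (-((e : ℝ) ^ 2 / (2 * (2 * j + e)))) := by
  set N := 2 * j + e with hN
  have hN0 : (0 : ℝ) < N := by
    have : 0 < N := by omega
    exact_mod_cast this
  have hNr : (2 * j + e : ℝ) = N := by rw [hN]; push_cast; ring
  set t : ℝ := e / N with ht
  have h1 : (N.choose j : ℝ) * Real.exp (t * e) ≤ (2 * Real.cosh t) ^ N := by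
    have h2 : 2 * Real.cosh t = Real.exp (-t) + Real.exp t := by rw [Real.cosh_eq]; ring
    rw [h2, add_pow]
    have h3 := Finset.single_le_sum
      (f := fun m => Real.exp (-t) ^ m * Real.exp t ^ (N - m) * (N.choose m : ℝ))
      (s := Finset.range (N + 1)) (fun i _ => by positivity)
      (show j ∈ Finset.range (N + 1) by rw [Finset.mem_range]; omega)
    refine le_trans (le_of_eq ?_) h3
    rw [← Real.exp_nat_mul, ← Real.exp_nat_mul, ← Real.exp_add, mul_comm]
    congr 2
    rw [show N - j = j + e by omega]
    push_cast
    ring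
  have h2 : (2 * Real.cosh t) ^ N ≤ 2 ^ N * Real.exp (N * (t ^ 2 / 2)) := by
    rw [mul_pow, Real.exp_nat_mul]
    have := Real.cosh_le_exp_half_sq t
    have h0 := (Real.cosh_pos t).le
    gcongr
  have h3 : -((e : ℝ) ^ 2 / (2 * (2 * j + e))) = N * (t ^ 2 / 2) - t * e := by
    rw [hNr, ht]
    field_simp
    ring
  rw [h3, Real.exp_sub, mul_div_assoc', le_div_iff₀ (Real.exp_pos _)]
  exact h1.trans h2

/-! ### Upper and lower bounds for `P` -/

/-- Every value of `P` within range is given by the product formula, up to the symmetry under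
reversal. -/
theorem exists_params {n : ℕ} {j k : ℤ} (h : (1 ≤ j ∧ j ≤ n) ∧ (1 ≤ k ∧ k ≤ n)) :
    ∃ j' k' e : ℕ, n = j' + k' + e + 1 ∧
      P n j k = P (j' + k' + e + 1) ((j' : ℤ) + 1) ((k' : ℤ) + 1) ∧
      ((e : ℤ) + 1 = |n + 1 - j - k| + 1) ∧
      min (j - 1) (n - j) ≤ j' ∧ min (k - 1) (n - k) ≤ k' := by
  obtain ⟨⟨h1, h2⟩, h3, h4⟩ := h
  rcases le_total 0 ((n : ℤ) + 1 - j - k) with h | h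
  · refine ⟨(j - 1).toNat, (k - 1).toNat, (n + 1 - j - k).toNat, by omega, ?_, ?_, by omega,
      by omega⟩
    · congr 1 <;> omega
    · rw [abs_of_nonneg h]
      omega
  · refine ⟨(n - j).toNat, (n - k).toNat, (j + k - n - 1).toNat, by omega, ?_, ?_, by omega,
      by omega⟩
    · rw [← P_rev]
      congr 1 <;> omega
    · rw [abs_of_nonpos h]
      omega

theorem P_mul_real (j k e : ℕ) :
    (P (j + k + e + 1) ((j : ℤ) + 1) ((k : ℤ) + 1) : ℝ) *
        ((2 * j + (e + 1)) * (2 * k + (e + 1))) =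
      ((e : ℝ) + 1) ^ 2 * ((2 * j + (e + 1)).choose j * (2 * k + (e + 1)).choose k) := by
  have h := P_mul j k e
  simp only [add_assoc] at h ⊢
  exact_mod_cast h

theorem P_le_exp (n : ℕ) (j k : ℤ) :
    (P n j k : ℝ) ≤ 4 ^ n * Real.exp (-((|(n : ℝ) + 1 - j - k| + 1) ^ 2 / (2 * n))) := by
  by_cases h : (1 ≤ j ∧ j ≤ n) ∧ (1 ≤ k ∧ k ≤ n)
  swap
  · rw [P_eq_zero h, Nat.cast_zero]
    positivity
  obtain ⟨x, y, e, hn, hP, he, -, -⟩ := exists_params h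
  have hE : |(n : ℝ) + 1 - j - k| + 1 = e + 1 := by exact_mod_cast he.symm
  rw [hE, hP]
  have hmul := P_mul_real x y e
  have h1 := choose_le_two_pow_mul_exp x (e + 1) (by omega)
  have h2 := choose_le_two_pow_mul_exp y (e + 1) (by omega)
  push_cast at h1 h2
  set A : ℝ := Nat.cast ((2 * x + (e + 1)).choose x)
  set B : ℝ := Nat.cast ((2 * y + (e + 1)).choose y)
  set p : ℝ := Nat.cast (P (x + y + e + 1) ((x : ℤ) + 1) ((y : ℤ) + 1))
  have hA : 0 ≤ A := by positivity
  have hB : 0 ≤ B := by positivity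
  have hx : (0 : ℝ) ≤ x := by positivity
  have hy : (0 : ℝ) ≤ y := by positivity
  have he0 : (0 : ℝ) ≤ e := by positivity
  have hnr : (n : ℝ) = x + y + e + 1 := by rw [hn]; push_cast; ring
  have hpAB : p ≤ A * B := by
    have h3 : ((e : ℝ) + 1) ^ 2 ≤ (2 * x + (e + 1)) * (2 * y + (e + 1)) := by nlinarith
    have h4 : (0 : ℝ) < (2 * x + (e + 1)) * (2 * y + (e + 1)) := by positivity
    refine le_of_mul_le_mul_right ?_ h4
    rw [hmul, mul_comm (A * B)]
    gcongr
  calc p ≤ A * B := hpAB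
    _ ≤ (2 ^ (2 * x + (e + 1)) * Real.exp (-(((e : ℝ) + 1) ^ 2 / (2 * (2 * n))))) *
        (2 ^ (2 * y + (e + 1)) * Real.exp (-(((e : ℝ) + 1) ^ 2 / (2 * (2 * n))))) := by
      gcongr
      · exact h1.trans (by gcongr; linarith)
      · exact h2.trans (by gcongr; linarith)
    _ = 4 ^ n * Real.exp (-(((e : ℝ) + 1) ^ 2 / (2 * n))) := by
      rw [mul_mul_mul_comm, ← pow_add, ← Real.exp_add,
        show 2 * x + (e + 1) + (2 * y + (e + 1)) = 2 * n by omega, pow_mul]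
      norm_num
      ring

theorem succ_mul_catalan_real (n : ℕ) : ((n : ℝ) + 1) * catalan n = n.centralBinom := by
  exact_mod_cast succ_mul_catalan_eq_centralBinom n

/-- The upper bound of order `E ^ 2 / n ^ (3 / 2)`, where `E - 1` is the distance to the
antidiagonal. -/
theorem P_mul_le {n : ℕ} {j k : ℤ} {κ : ℝ} (hκ : 0 < κ) (hn : 1 ≤ n)
    (hj : κ * n ≤ min ((j : ℝ) - 1) (n - j)) (hk : κ * n ≤ min ((k : ℝ) - 1) (n - k)) :
    κ ^ 3 * ((P n j k : ℝ) * (n * √n)) ≤ (|(n : ℝ) + 1 - j - k| + 1) ^ 2 * catalan n := by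
  by_cases h : (1 ≤ j ∧ j ≤ n) ∧ (1 ≤ k ∧ k ≤ n)
  swap
  · rw [P_eq_zero h]
    simp only [Nat.cast_zero, zero_mul, mul_zero]
    positivity
  obtain ⟨x, y, e, hxy, hP, he, hx, hy⟩ := exists_params h
  have hE : |(n : ℝ) + 1 - j - k| + 1 = e + 1 := by exact_mod_cast he.symm
  rw [hE, hP]
  have hx' : min ((j : ℝ) - 1) (n - j) ≤ x := by exact_mod_cast hx
  have hy' : min ((k : ℝ) - 1) (n - k) ≤ y := by exact_mod_cast hy
  replace hx' := hj.trans hx'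
  replace hy' := hk.trans hy'
  have hn0 : (1 : ℝ) ≤ n := by exact_mod_cast hn
  have hmul := P_mul_real x y e
  have h1 := choose_le_centralBinom_mul x (e + 1)
  have h2 := choose_le_centralBinom_mul y (e + 1)
  have c1 := centralBinom_mul_sqrt_le x
  have c2 := centralBinom_mul_sqrt_le y
  have c3 := le_centralBinom_mul_sqrt hn
  rw [← succ_mul_catalan_real] at c3
  set A : ℝ := Nat.cast ((2 * x + (e + 1)).choose x)
  set B : ℝ := Nat.cast ((2 * y + (e + 1)).choose y)
  set p : ℝ := Nat.cast (P (x + y + e + 1) ((x : ℤ) + 1) ((y : ℤ) + 1))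
  set C : ℝ := Nat.cast (catalan n)
  have hp : 0 ≤ p := by positivity
  have hκn : 0 < κ * n := by positivity
  have hsq : κ * n ≤ √x * √y := by
    rw [← Real.sqrt_mul (by positivity)]
    apply Real.le_sqrt_of_sq_le
    nlinarith
  have hs0 : 0 < √(n : ℝ) := by positivity
  have hAB : A * B * (√x * √y) ≤ 4 ^ n := by
    calc A * B * (√x * √y)
        ≤ (x.centralBinom * 2 ^ (e + 1)) * (y.centralBinom * 2 ^ (e + 1)) * (√x * √y) := by
          gcongr
      _ = (x.centralBinom * √x) * (y.centralBinom * √y) * (2 ^ (e + 1) * 2 ^ (e + 1)) := by ring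
      _ ≤ 4 ^ x * 4 ^ y * (2 ^ (e + 1) * 2 ^ (e + 1)) := by gcongr
      _ = 4 ^ n := by
          rw [← mul_pow, hxy]
          norm_num
          ring
  -- Two factors `κ n` come from the denominators of the product formula, the third from `√x √y`.
  have h3 : p * (4 * (κ * n) ^ 2) * (κ * n) ≤ ((e : ℝ) + 1) ^ 2 * 4 ^ n := by
    calc p * (4 * (κ * n) ^ 2) * (κ * n)
        = p * ((2 * (κ * n)) * (2 * (κ * n))) * (κ * n) := by ring
      _ ≤ p * ((2 * x + (e + 1)) * (2 * y + (e + 1))) * (√x * √y) := by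
          gcongr
          · linarith
          · linarith
      _ = ((e : ℝ) + 1) ^ 2 * (A * B * (√x * √y)) := by rw [hmul]; ring
      _ ≤ _ := by gcongr
  have hC : 0 ≤ C := by positivity
  have h4 : (4 : ℝ) ^ n ≤ 4 * (n * √n) * C := by
    refine c3.trans ?_
    have : ((n : ℝ) + 1) ≤ 2 * n := by linarith
    calc 2 * (((n : ℝ) + 1) * C * √n) ≤ 2 * ((2 * n) * C * √n) := by gcongr
      _ = _ := by ring
  have h5 : (0 : ℝ) < 4 * (n * √n) := by positivity
  refine le_of_mul_le_mul_left ?_ h5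
  calc 4 * (n * √n) * (κ ^ 3 * (p * (n * √n)))
      = p * (4 * (κ * n) ^ 2) * (κ * √n ^ 2) := by ring
    _ = p * (4 * (κ * n) ^ 2) * (κ * n) := by rw [Real.sq_sqrt (by positivity)]
    _ ≤ ((e : ℝ) + 1) ^ 2 * (4 * (n * √n) * C) := h3.trans (by gcongr)
    _ = _ := by ring

/-- The lower bound matching `P_mul_le`. -/
theorem le_P_mul {n : ℕ} {j k : ℤ} {κ : ℝ} (hκ : 0 < κ) (hn : 1 ≤ n)
    (hj : κ * n ≤ min ((j : ℝ) - 1) (n - j)) (hk : κ * n ≤ min ((k : ℝ) - 1) (n - k)) :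
    (|(n : ℝ) + 1 - j - k| + 1) ^ 2 *
        Real.exp (-(2 * ((|(n : ℝ) + 1 - j - k| + 1) ^ 2 / (κ * n)))) * catalan n ≤
      16 * ((P n j k : ℝ) * (n * √n)) := by
  have hn0 : (1 : ℝ) ≤ n := by exact_mod_cast hn
  have hκn : 0 < κ * n := by positivity
  have h : (1 ≤ j ∧ j ≤ n) ∧ (1 ≤ k ∧ k ≤ n) := by
    rw [le_min_iff] at hj hk
    have a1 : (1 : ℝ) ≤ j := by linarith
    have a2 : (j : ℝ) ≤ n := by linarith
    have a3 : (1 : ℝ) ≤ k := by linarith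
    have a4 : (k : ℝ) ≤ n := by linarith
    exact ⟨⟨by exact_mod_cast a1, by exact_mod_cast a2⟩, by exact_mod_cast a3,
      by exact_mod_cast a4⟩
  obtain ⟨x, y, e, hxy, hP, he, hx, hy⟩ := exists_params h
  have hE : |(n : ℝ) + 1 - j - k| + 1 = e + 1 := by exact_mod_cast he.symm
  rw [hE, hP]
  have hx' : min ((j : ℝ) - 1) (n - j) ≤ x := by exact_mod_cast hx
  have hy' : min ((k : ℝ) - 1) (n - k) ≤ y := by exact_mod_cast hy
  replace hx' := hj.trans hx'
  replace hy' := hk.trans hy'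
  have hx1 : 1 ≤ x := by
    have : (0 : ℝ) < x := by linarith
    exact_mod_cast this
  have hy1 : 1 ≤ y := by
    have : (0 : ℝ) < y := by linarith
    exact_mod_cast this
  have hnr : (n : ℝ) = x + y + e + 1 := by rw [hxy]; push_cast; ring
  have hmul := P_mul_real x y e
  have h1 := centralBinom_mul_exp_le_choose hx1 (e + 1)
  have h2 := centralBinom_mul_exp_le_choose hy1 (e + 1)
  push_cast at h1 h2
  have c1 := le_centralBinom_mul_sqrt hx1
  have c2 := le_centralBinom_mul_sqrt hy1
  have c3 := centralBinom_mul_sqrt_le n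
  rw [← succ_mul_catalan_real] at c3
  set A : ℝ := Nat.cast ((2 * x + (e + 1)).choose x)
  set B : ℝ := Nat.cast ((2 * y + (e + 1)).choose y)
  set p : ℝ := Nat.cast (P (x + y + e + 1) ((x : ℤ) + 1) ((y : ℤ) + 1))
  set C : ℝ := Nat.cast (catalan n)
  set q : ℝ := ((e : ℝ) + 1) ^ 2 with hq
  have hp : 0 ≤ p := by positivity
  have hC : 0 ≤ C := by positivity
  have he0 : (0 : ℝ) ≤ e := by positivity
  have hsq : √x * √y ≤ n := by
    rw [← Real.sqrt_mul (by positivity)]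
    apply Real.sqrt_le_iff.2
    constructor
    · positivity
    · have : (x : ℝ) ≤ n := by linarith
      have : (y : ℝ) ≤ n := by linarith
      rw [sq]
      gcongr
  have hs0 : 0 < √(n : ℝ) := by positivity
  have hexp : Real.exp (-(2 * (q / (κ * n)))) ≤ Real.exp (-(q / x)) * Real.exp (-(q / y)) := by
    rw [← Real.exp_add]
    apply Real.exp_le_exp.2
    have a1 : q / x ≤ q / (κ * n) := by gcongr
    have a2 : q / y ≤ q / (κ * n) := by gcongr
    linarith
  set r := Real.exp (-(2 * (q / (κ * n))))
  have hr : 0 < r := Real.exp_pos _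
  have hAB : 4 ^ n * r ≤ 4 * n * (A * B) := by
    have hpow : (4 : ℝ) ^ n = 4 ^ x * 4 ^ y * (2 ^ (e + 1) * 2 ^ (e + 1)) := by
      rw [← mul_pow, hxy]
      norm_num
      ring
    calc 4 ^ n * r = 4 ^ x * 4 ^ y * (2 ^ (e + 1) * 2 ^ (e + 1)) * r := by rw [hpow]
      _ ≤ (2 * (x.centralBinom * √x)) * (2 * (y.centralBinom * √y)) *
          (2 ^ (e + 1) * 2 ^ (e + 1)) * (Real.exp (-(q / x)) * Real.exp (-(q / y))) := by
          gcongr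
      _ = 4 * (√x * √y) * ((x.centralBinom * 2 ^ (e + 1) * Real.exp (-(q / x))) *
          (y.centralBinom * 2 ^ (e + 1) * Real.exp (-(q / y)))) := by ring
      _ ≤ _ := by gcongr
  have h4 : n * √n * C ≤ 4 ^ n := by
    refine le_trans ?_ c3
    calc n * √n * C = n * C * √n := by ring
      _ ≤ (n + 1) * C * √n := by
        gcongr
        linarith
  have h3 : q * (A * B) ≤ p * (4 * n ^ 2) := by
    rw [← hmul]
    have h6 : (2 * (x : ℝ) + (e + 1)) * (2 * y + (e + 1)) ≤ (2 * n) * (2 * n) := by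
      gcongr <;> linarith
    calc _ ≤ p * ((2 * n) * (2 * n)) := by gcongr
      _ = _ := by ring
  have h5 : (0 : ℝ) < n * √n := by positivity
  refine le_of_mul_le_mul_left ?_ h5
  calc n * √n * (q * r * C) = q * ((n * √n * C) * r) := by ring
    _ ≤ q * (4 ^ n * r) := by gcongr
    _ ≤ q * (4 * n * (A * B)) := by gcongr
    _ = 4 * n * (q * (A * B)) := by ring
    _ ≤ 4 * n * (p * (4 * n ^ 2)) := by gcongr
    _ = 16 * (p * (n * n * n)) := by ring
    _ = 16 * (p * (n * n * √n ^ 2)) := by rw [Real.sq_sqrt (by positivity)]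
    _ = _ := by ring

theorem four_pow_le_mul_catalan {n : ℕ} (hn : 1 ≤ n) : (4 : ℝ) ^ n ≤ 4 * n ^ 2 * catalan n := by
  have c3 := le_centralBinom_mul_sqrt hn
  rw [← succ_mul_catalan_real] at c3
  have hn0 : (1 : ℝ) ≤ n := by exact_mod_cast hn
  have hs : √(n : ℝ) ≤ n := by
    rw [Real.sqrt_le_iff]
    constructor
    · positivity
    · nlinarith
  refine c3.trans ?_
  calc 2 * (((n : ℝ) + 1) * catalan n * √n) ≤ 2 * ((n + n) * catalan n * n) := by gcongr
    _ = _ := by ring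

theorem catalan_pos_real (n : ℕ) : (0 : ℝ) < catalan n := by
  have h := succ_mul_catalan_real n
  have h1 : (0 : ℝ) < n.centralBinom := by exact_mod_cast n.centralBinom_pos
  rw [← h] at h1
  exact pos_of_mul_pos_right h1 (by positivity)

/-! ### From orders of magnitude to the exponent -/

theorem sSup_exponents_eq_top {f : ℕ → ℝ}
    (h : ∀ d : ℝ, 0 ≤ d → Tendsto (fun n : ℕ => (n : ℝ) ^ d * f n) atTop (𝓝 0)) :
    sSup ((fun d : ℝ => (d : EReal)) '' {d : ℝ | 0 ≤ d ∧ ∃ l : ℝ,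
      Tendsto (fun n : ℕ => (n : ℝ) ^ d * f n) atTop (𝓝 l)}) = ⊤ := by
  rw [sSup_eq_top]
  intro x hx
  obtain ⟨y, hxy, -⟩ := EReal.lt_iff_exists_real_btwn.1 hx
  refine ⟨_, ⟨max y 0, ⟨le_max_right _ _, 0, h _ (le_max_right _ _)⟩, rfl⟩, hxy.trans_le ?_⟩
  exact EReal.coe_le_coe_iff.2 (le_max_left _ _)

theorem tendsto_natCast_rpow_atTop {y : ℝ} (hy : 0 < y) :
    Tendsto (fun n : ℕ => (n : ℝ) ^ y) atTop atTop :=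
  (tendsto_rpow_atTop hy).comp tendsto_natCast_atTop_atTop

/-- The order of magnitude suffices: below `D` the limit is `0`, above `D` the sequence diverges,
and whether the limit exists at `D` itself does not affect the supremum. -/
theorem sSup_exponents_eq {f : ℕ → ℝ} {D κ K : ℝ} (hD : 0 < D) (hκ : 0 < κ)
    (h1 : ∀ᶠ n : ℕ in atTop, κ * (n : ℝ) ^ (-D) ≤ f n)
    (h2 : ∀ᶠ n : ℕ in atTop, f n ≤ K * (n : ℝ) ^ (-D)) :
    sSup ((fun d : ℝ => (d : EReal)) '' {d : ℝ | 0 ≤ d ∧ ∃ l : ℝ,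
      Tendsto (fun n : ℕ => (n : ℝ) ^ d * f n) atTop (𝓝 l)}) = (D : EReal) := by
  have hpow : ∀ d c : ℝ, ∀ n : ℕ, 1 ≤ n →
      (n : ℝ) ^ d * (c * (n : ℝ) ^ (-D)) = c * (n : ℝ) ^ (d - D) := by
    intro d c n hn
    have hn0 : (0 : ℝ) < n := by exact_mod_cast hn
    rw [sub_eq_add_neg, Real.rpow_add hn0]
    ring
  apply le_antisymm
  · apply sSup_le
    rintro _ ⟨d, ⟨-, l, hl⟩, rfl⟩
    refine EReal.coe_le_coe_iff.2 (not_lt.1 fun hlt => ?_)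
    refine not_tendsto_nhds_of_tendsto_atTop ?_ l hl
    refine tendsto_atTop_mono' atTop ?_
      ((tendsto_natCast_rpow_atTop (sub_pos.2 hlt)).const_mul_atTop hκ)
    filter_upwards [h1, eventually_ge_atTop 1] with n hn hn1
    rw [← hpow d κ n hn1]
    gcongr
  · refine le_of_forall_lt fun x hx => ?_
    obtain ⟨y, hxy, hy⟩ := EReal.lt_iff_exists_real_btwn.1 hx
    have hyD : max y 0 < D := max_lt (EReal.coe_lt_coe_iff.1 hy) hD
    refine (hxy.trans_le (EReal.coe_le_coe_iff.2 (le_max_left y 0))).trans_le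
      (le_sSup ⟨max y 0, ⟨le_max_right _ _, 0, ?_⟩, rfl⟩)
    have h3 : Tendsto (fun n : ℕ => K * (n : ℝ) ^ (max y 0 - D)) atTop (𝓝 0) := by
      have := (tendsto_rpow_neg_atTop (sub_pos.2 hyD)).comp tendsto_natCast_atTop_atTop
      simpa using this.const_mul K
    refine tendsto_of_tendsto_of_tendsto_of_le_of_le' tendsto_const_nhds h3 ?_ ?_
    · filter_upwards [h1] with n hn
      have : 0 ≤ f n := le_trans (by positivity) hn
      positivity
    · filter_upwards [h2, eventually_ge_atTop 1] with n hn hn1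
      rw [← hpow _ K n hn1]
      gcongr

theorem eventually_rpow_le_mul {α ε : ℝ} (hα : α < 1) (hε : 0 < ε) :
    ∀ᶠ n : ℕ in atTop, (n : ℝ) ^ α ≤ ε * n := by
  have h := (tendsto_rpow_neg_atTop (sub_pos.2 hα)).comp tendsto_natCast_atTop_atTop
  filter_upwards [h.eventually_le_const hε, eventually_ge_atTop 1] with n hn hn1
  have hn0 : (0 : ℝ) < n := by exact_mod_cast hn1
  simp only [Function.comp_apply, neg_sub] at hn
  rw [Real.rpow_sub hn0, Real.rpow_one, div_le_iff₀ hn0] at hn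
  exact hn

/-- Superpolynomial decay when the distance to the antidiagonal is at least of order `n ^ β` with
`1 / 2 < β`. -/
theorem tendsto_rpow_mul_P_div_catalan {J K : ℕ → ℤ} {β κ : ℝ} (hβ : 1 / 2 < β) (hκ : 0 < κ)
    (h : ∀ᶠ n : ℕ in atTop, κ * (n : ℝ) ^ β ≤ |(n : ℝ) + 1 - J n - K n| + 1) (d : ℝ) :
    Tendsto (fun n : ℕ => (n : ℝ) ^ d * ((P n (J n) (K n) : ℝ) / (catalan n : ℝ))) atTop (𝓝 0) := by
  have hγ : 0 < 2 * β - 1 := by linarith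
  -- In the variable `n^(2β-1)` this power is `n^(d+2)`; the extra `n²` pays for `4^n ≤ 4 n² C_n`.
  have h1 := ((tendsto_rpow_mul_exp_neg_mul_atTop_nhds_zero ((d + 2) / (2 * β - 1)) (κ ^ 2 / 2)
    (by positivity)).comp (tendsto_natCast_rpow_atTop hγ)).const_mul 4
  rw [mul_zero] at h1
  refine tendsto_of_tendsto_of_tendsto_of_le_of_le' tendsto_const_nhds h1
    (Eventually.of_forall fun n => by positivity) ?_
  filter_upwards [h, eventually_ge_atTop 1] with n hn hn1
  have hn0 : (0 : ℝ) < n := by exact_mod_cast hn1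
  have hC := catalan_pos_real n
  have h2 : (P n (J n) (K n) : ℝ) / catalan n ≤
      4 * n ^ 2 * Real.exp (-(κ ^ 2 / 2) * (n : ℝ) ^ (2 * β - 1)) := by
    rw [div_le_iff₀ hC]
    calc (P n (J n) (K n) : ℝ)
        ≤ 4 ^ n * Real.exp (-((|(n : ℝ) + 1 - J n - K n| + 1) ^ 2 / (2 * n))) := P_le_exp _ _ _
      _ ≤ 4 * n ^ 2 * catalan n * Real.exp (-((κ * (n : ℝ) ^ β) ^ 2 / (2 * n))) := by
          gcongr
          exact four_pow_le_mul_catalan hn1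
      _ = _ := by
          rw [show -((κ * (n : ℝ) ^ β) ^ 2 / (2 * n)) = -(κ ^ 2 / 2) * (n : ℝ) ^ (2 * β - 1) by
            rw [Real.rpow_sub hn0, Real.rpow_one, mul_comm 2 β, Real.rpow_mul hn0.le,
              Real.rpow_two]
            field_simp]
          ring
  simp only [Function.comp_apply]
  rw [← Real.rpow_mul hn0.le, mul_div_cancel₀ _ hγ.ne', Real.rpow_add hn0, Real.rpow_two]
  calc _ ≤ (n : ℝ) ^ d * (4 * n ^ 2 * Real.exp (-(κ ^ 2 / 2) * (n : ℝ) ^ (2 * β - 1))) := by gcongr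
    _ = _ := by ring

theorem mul_sqrt_mul_rpow {x β : ℝ} (hx : 0 < x) :
    x * √x * x ^ (-(3 / 2 - 2 * β)) = (x ^ β) ^ 2 := by
  rw [Real.sqrt_eq_rpow, ← Real.rpow_natCast, ← Real.rpow_mul hx.le]
  nth_rewrite 1 [← Real.rpow_one x]
  rw [← Real.rpow_add hx, ← Real.rpow_add hx]
  congr 1
  push_cast
  ring

/-- Points in the interior at distance of order `n ^ β`, `β ≤ 1 / 2`, from the antidiagonal. -/
theorem P_div_catalan_bounds {κ κ' L β : ℝ} (hκ : 0 < κ) (hκ' : 0 < κ') (hβ : β ≤ 1 / 2)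
    {n : ℕ} (hn : 1 ≤ n) {j k : ℤ}
    (hj : κ * n ≤ min ((j : ℝ) - 1) (n - j)) (hk : κ * n ≤ min ((k : ℝ) - 1) (n - k))
    (h1 : κ' * (n : ℝ) ^ β ≤ |(n : ℝ) + 1 - j - k| + 1)
    (h2 : |(n : ℝ) + 1 - j - k| + 1 ≤ L * (n : ℝ) ^ β) :
    κ' ^ 2 * Real.exp (-(2 * (L ^ 2 / κ))) / 16 * (n : ℝ) ^ (-(3 / 2 - 2 * β)) ≤
        (P n j k : ℝ) / catalan n ∧
      (P n j k : ℝ) / catalan n ≤ L ^ 2 / κ ^ 3 * (n : ℝ) ^ (-(3 / 2 - 2 * β)) := by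
  have hn0 : (0 : ℝ) < n := by exact_mod_cast hn
  have hC := catalan_pos_real n
  have hu := P_mul_le hκ hn hj hk
  have hl := le_P_mul hκ hn hj hk
  have hE1 : 1 ≤ |(n : ℝ) + 1 - j - k| + 1 := by linarith [abs_nonneg ((n : ℝ) + 1 - j - k)]
  set E := |(n : ℝ) + 1 - j - k| + 1
  have hs : 0 < (n : ℝ) * √n := by positivity
  have hpow := mul_sqrt_mul_rpow (β := β) hn0
  set t := (n : ℝ) ^ (-(3 / 2 - 2 * β))
  set w := (n : ℝ) ^ β with hw
  have hw0 : 0 < w := by positivity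
  constructor
  · rw [le_div_iff₀ hC]
    refine le_of_mul_le_mul_right ?_ hs
    -- Here `β ≤ 1/2` enters: it keeps `E² / n`, and so the exponential factor, bounded.
    have hwn : w ^ 2 ≤ n := by
      rw [hw, ← Real.rpow_natCast, ← Real.rpow_mul hn0.le]
      calc (n : ℝ) ^ (β * ((2 : ℕ) : ℝ)) ≤ (n : ℝ) ^ (1 : ℝ) := by
            apply Real.rpow_le_rpow_of_exponent_le
            · exact_mod_cast hn
            · push_cast
              linarith
        _ = n := Real.rpow_one _
    have hq : E ^ 2 / (κ * n) ≤ L ^ 2 / κ := by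
      rw [div_le_div_iff₀ (by positivity) hκ]
      calc E ^ 2 * κ ≤ (L * w) ^ 2 * κ := by gcongr
        _ = L ^ 2 * κ * w ^ 2 := by ring
        _ ≤ L ^ 2 * κ * n := by gcongr
        _ = _ := by ring
    calc κ' ^ 2 * Real.exp (-(2 * (L ^ 2 / κ))) / 16 * t * catalan n * (n * √n)
        = κ' ^ 2 * Real.exp (-(2 * (L ^ 2 / κ))) / 16 * catalan n * (n * √n * t) := by ring
      _ = ((κ' * w) ^ 2 * Real.exp (-(2 * (L ^ 2 / κ))) * catalan n) / 16 := by rw [hpow]; ring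
      _ ≤ (E ^ 2 * Real.exp (-(2 * (E ^ 2 / (κ * n)))) * catalan n) / 16 := by gcongr
      _ ≤ _ := by linarith
  · rw [div_le_iff₀ hC]
    have hκs : 0 < κ ^ 3 * ((n : ℝ) * √n) := by positivity
    refine le_of_mul_le_mul_left ?_ hκs
    calc κ ^ 3 * ((n : ℝ) * √n) * P n j k = κ ^ 3 * (P n j k * (n * √n)) := by ring
      _ ≤ E ^ 2 * catalan n := hu
      _ ≤ (L * w) ^ 2 * catalan n := by gcongr
      _ = κ ^ 3 * (L ^ 2 / κ ^ 3) * (w ^ 2) * catalan n := by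
          field_simp
      _ = _ := by rw [← hpow]; ring

/-! ### Rounding errors and the cases of the theorem -/

theorem abs_shift_le (a b α : ℝ) : |shift a b α| ≤ 1 := by
  unfold shift
  split_ifs <;> simp

theorem F_eq_sSup (r s : ℝ → ℤ) (a b c α : ℝ) :
    F r s a b c α = sSup ((fun d : ℝ => (d : EReal)) '' {d : ℝ | 0 ≤ d ∧ ∃ l : ℝ,
      Tendsto (fun n : ℕ => (n : ℝ) ^ d *
        ((P n (r (a * n - c * (n : ℝ) ^ α + shift a b α)) (s (b * n - c * (n : ℝ) ^ α)) : ℝ) /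
          (catalan n : ℝ))) atTop (𝓝 l)}) := by
  simp only [F, mul_div_assoc]

theorem abs_round_shift_sub_le {r : ℝ → ℤ} (hr : IsRounding r) (a b c α : ℝ) (n : ℕ) :
    |(r (a * n - c * (n : ℝ) ^ α + shift a b α) : ℝ) - (a * n - c * (n : ℝ) ^ α)| ≤ 2 := by
  have h1 := abs_lt.1 (hr (a * n - c * (n : ℝ) ^ α + shift a b α))
  have h2 := abs_le.1 (abs_shift_le a b α)
  rw [abs_le]
  constructor <;> linarith [h1.1, h1.2, h2.1, h2.2]

theorem abs_distance_sub_le {r s : ℝ → ℤ} (hr : IsRounding r) (hs : IsRounding s) (a b c α : ℝ) (n : ℕ) :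
    |(n : ℝ) + 1 - r (a * n - c * (n : ℝ) ^ α + shift a b α) - s (b * n - c * (n : ℝ) ^ α) -
      ((1 - a - b) * n + 2 * c * (n : ℝ) ^ α)| ≤ 4 := by
  have h1 := abs_le.1 (abs_round_shift_sub_le hr a b c α n)
  have h2 := abs_lt.1 (hs (b * n - c * (n : ℝ) ^ α))
  rw [abs_le]
  constructor <;> nlinarith [h1.1, h1.2, h2.1, h2.2]

theorem F_eq_top_of_le {r s : ℝ → ℤ} (hr : IsRounding r) (hs : IsRounding s) {a b c α β κ : ℝ}
    (hβ : 1 / 2 < β) (hκ : 0 < κ)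
    (h : ∀ᶠ n : ℕ in atTop, κ * (n : ℝ) ^ β ≤ |(1 - a - b) * n + 2 * c * (n : ℝ) ^ α|) :
    F r s a b c α = ⊤ := by
  rw [F_eq_sSup]
  -- The constant `κ / 4` absorbs the rounding error: `|y| ≤ |x| + 4 ≤ 4 (|x| + 1)`.
  refine sSup_exponents_eq_top fun d _ =>
    tendsto_rpow_mul_P_div_catalan (κ := κ / 4) hβ (by positivity) ?_ d
  filter_upwards [h] with n hn
  have h1 := abs_distance_sub_le hr hs a b c α n
  set x := (n : ℝ) + 1 - r (a * n - c * (n : ℝ) ^ α + shift a b α) - s (b * n - c * (n : ℝ) ^ α)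
  set y := (1 - a - b) * n + 2 * c * (n : ℝ) ^ α
  have h2 := abs_sub_abs_le_abs_sub y x
  rw [abs_sub_comm y x] at h2
  linarith [abs_nonneg x]

/-- The `+ 1` in the lower hypothesis lets `β = 0` cover `c = 0`, where the main term of the
distance vanishes. -/
theorem F_eq_coe_of_le {r s : ℝ → ℤ} (hr : IsRounding r) (hs : IsRounding s) {a b c α β κ L : ℝ}
    (hab : a + b = 1) (ha : 0 < a) (ha' : a < 1) (hα : α < 1) (hβ0 : 0 ≤ β) (hβ : β ≤ 1 / 2)
    (hκ : 0 < κ)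
    (h : ∀ᶠ n : ℕ in atTop, κ * (n : ℝ) ^ β ≤ |2 * c * (n : ℝ) ^ α| + 1 ∧
      |2 * c * (n : ℝ) ^ α| ≤ L * (n : ℝ) ^ β) :
    F r s a b c α = ((3 / 2 - 2 * β : ℝ) : EReal) := by
  rw [F_eq_sSup]
  obtain rfl : b = 1 - a := by linarith
  set m : ℝ := min a (1 - a) / 2 with hm
  have hm0 : 0 < m := by
    have : 0 < min a (1 - a) := lt_min ha (by linarith)
    positivity
  have hma : 2 * m ≤ a := by
    rw [hm]; linarith [min_le_left a (1 - a)]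
  have hmb : 2 * m ≤ 1 - a := by
    rw [hm]; linarith [min_le_right a (1 - a)]
  have hmain : ∀ᶠ n : ℕ in atTop,
      (κ / 5) ^ 2 * Real.exp (-(2 * ((L + 5) ^ 2 / m))) / 16 * (n : ℝ) ^ (-(3 / 2 - 2 * β)) ≤
        (P n (r (a * n - c * (n : ℝ) ^ α + shift a (1 - a) α))
          (s ((1 - a) * n - c * (n : ℝ) ^ α)) : ℝ) / catalan n ∧
      (P n (r (a * n - c * (n : ℝ) ^ α + shift a (1 - a) α))
          (s ((1 - a) * n - c * (n : ℝ) ^ α)) : ℝ) / catalan n ≤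
        (L + 5) ^ 2 / m ^ 3 * (n : ℝ) ^ (-(3 / 2 - 2 * β)) := by
    have hc : 0 < m / (2 * (|c| + 1)) := by positivity
    -- Both indices are within `m n / 2 + 2` of `a n` and `(1 - a) n`, which are at least `2 m n`
    -- from `0` and `n`. The bound `6 / m` gives `3 ≤ m n / 2`, so a margin `m n` remains.
    filter_upwards [h, eventually_ge_atTop 1, eventually_rpow_le_mul hα hc,
      (tendsto_natCast_atTop_atTop (R := ℝ)).eventually_ge_atTop (6 / m)] with n hn hn1 hnα hnm
    have hn0 : (1 : ℝ) ≤ n := by exact_mod_cast hn1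
    have hz : |c * (n : ℝ) ^ α| ≤ m / 2 * n := by
      have h0 : (0 : ℝ) ≤ (n : ℝ) ^ α := by positivity
      rw [abs_mul, abs_of_nonneg h0]
      calc |c| * (n : ℝ) ^ α ≤ (|c| + 1) * (m / (2 * (|c| + 1)) * n) := by
            gcongr
            linarith
        _ = m / 2 * n := by field_simp
    have h3 : 3 ≤ m / 2 * n := by
      rw [div_le_iff₀ hm0] at hnm
      linarith
    have h1 := abs_le.1 (abs_round_shift_sub_le hr a (1 - a) c α n)
    have h2 := abs_lt.1 (hs ((1 - a) * n - c * (n : ℝ) ^ α))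
    have h4 := abs_distance_sub_le hr hs a (1 - a) c α n
    rw [show 1 - a - (1 - a) = 0 by ring, zero_mul, zero_add] at h4
    have hz' := abs_le.1 hz
    have hma' : 2 * m * n ≤ a * n := by gcongr
    have hmb' : 2 * m * n ≤ (1 - a) * n := by gcongr
    have hw : 1 ≤ (n : ℝ) ^ β := Real.one_le_rpow hn0 hβ0
    -- The distance differs from `2 c n^α` by at most `4`. Together with the `1` in `E` this gives
    -- the `5` in both constants, using `E ≥ 1` below and `n^β ≥ 1` above.
    refine P_div_catalan_bounds (κ := m) (κ' := κ / 5) (L := L + 5) hm0 (by positivity) hβ hn1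
      (j := r (a * n - c * (n : ℝ) ^ α + shift a (1 - a) α))
      (k := s ((1 - a) * n - c * (n : ℝ) ^ α))
      (le_min ?_ ?_) (le_min ?_ ?_) ?_ ?_
    · linarith [h1.1, hz'.2]
    · linarith [h1.2, hz'.1]
    · linarith [h2.1, hz'.2]
    · linarith [h2.2, hz'.1]
    · have h5 := abs_sub_abs_le_abs_sub (2 * c * (n : ℝ) ^ α)
        ((n : ℝ) + 1 - r (a * n - c * (n : ℝ) ^ α + shift a (1 - a) α) -
          s ((1 - a) * n - c * (n : ℝ) ^ α))
      rw [abs_sub_comm (2 * c * (n : ℝ) ^ α)] at h5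
      linarith [hn.1, abs_nonneg ((n : ℝ) + 1 -
        r (a * n - c * (n : ℝ) ^ α + shift a (1 - a) α) - s ((1 - a) * n - c * (n : ℝ) ^ α))]
    · have h5 := abs_sub_abs_le_abs_sub
        ((n : ℝ) + 1 - r (a * n - c * (n : ℝ) ^ α + shift a (1 - a) α) -
          s ((1 - a) * n - c * (n : ℝ) ^ α)) (2 * c * (n : ℝ) ^ α)
      linarith [hn.2]
  exact sSup_exponents_eq (by linarith) (by positivity) (hmain.mono fun _ h => h.1)
    (hmain.mono fun _ h => h.2)

end PatternShape

theorem theoremT1 (r s : ℝ → ℤ) (hr : PatternShape.IsRounding r) (hs : PatternShape.IsRounding s)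
    (a b c α : ℝ) (ha : 0 ≤ a ∧ a ≤ 1) (hb : 0 ≤ b ∧ b ≤ 1) (hα : 0 ≤ α ∧ α < 1) :
    (a + b ≠ 1 → PatternShape.F r s a b c α = ⊤) ∧
    (a + b = 1 → c ≠ 0 → 1 / 2 < α → PatternShape.F r s a b c α = ⊤) ∧
    (a + b = 1 → 0 < a → a < 1 → c = 0 →
      PatternShape.F r s a b c α = ((3 / 2 : ℝ) : EReal)) ∧
    (a + b = 1 → 0 < a → a < 1 → c ≠ 0 → α ≤ 1 / 2 →
      PatternShape.F r s a b c α = ((3 / 2 - 2 * α : ℝ) : EReal)) := by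
  have habs : ∀ n : ℕ, |2 * c * (n : ℝ) ^ α| = 2 * |c| * (n : ℝ) ^ α := fun n => by
    rw [abs_mul, abs_mul, abs_two, abs_of_nonneg (by positivity : (0 : ℝ) ≤ (n : ℝ) ^ α)]
  refine ⟨fun hab => ?_, fun hab hc hα' => ?_, fun hab ha0 ha1 hc => ?_,
    fun hab ha0 ha1 hc hα' => ?_⟩
  · have h0 : 0 < |1 - a - b| := abs_pos.2 fun h => hab (by linarith)
    refine PatternShape.F_eq_top_of_le hr hs (β := 1) (κ := |1 - a - b| / 2) (by norm_num)
      (by positivity) ?_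
    have hε : 0 < |1 - a - b| / (4 * (|c| + 1)) := by positivity
    filter_upwards [PatternShape.eventually_rpow_le_mul hα.2 hε] with n hn
    have h1 : 2 * |c| * (n : ℝ) ^ α ≤ |1 - a - b| / 2 * n := by
      calc 2 * |c| * (n : ℝ) ^ α
          ≤ 2 * (|c| + 1) * (|1 - a - b| / (4 * (|c| + 1)) * n) := by
            gcongr
            linarith
        _ = |1 - a - b| / 2 * n := by
            field_simp
            norm_num
    have h2 := abs_sub_abs_le_abs_add ((1 - a - b) * (n : ℝ)) (2 * c * (n : ℝ) ^ α)
    rw [habs, abs_mul, Nat.abs_cast] at h2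
    rw [Real.rpow_one]
    linarith
  · refine PatternShape.F_eq_top_of_le hr hs hα' (κ := 2 * |c|) (by positivity) ?_
    refine Eventually.of_forall fun n => ?_
    rw [show 1 - a - b = 0 by linarith, zero_mul, zero_add, habs]
  · have h := PatternShape.F_eq_coe_of_le hr hs (c := c) (β := 0) (κ := 1) (L := 0) hab ha0 ha1
      hα.2 le_rfl (by norm_num) one_pos (Eventually.of_forall fun n => by simp [hc])
    simpa using h
  · refine PatternShape.F_eq_coe_of_le hr hs (κ := 2 * |c|) (L := 2 * |c|) hab ha0 ha1 hα.2 hα.1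
      hα' (by positivity) (Eventually.of_forall fun n => ?_)
    rw [habs]
    exact ⟨by linarith, le_rfl⟩
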